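/- Let $\mathcal L\subset\mathbb C$ be a period lattice, that is, $\mathcal L=\mathbb Z\omega_1+\mathbb Z\omega_2$ with $\omega_1,\omega_2$ nonzero complex numbers whose ratio is not real, and let $\wp_{\mathcal L}(z)=z^{-2}+\sum_{l\in\mathcal L\setminus\{0\}}\bigl((z-l)^{-2}-l^{-2}\bigr)$ be its Weierstrass function. (1) The function $u=\wp_{\mathcal L}$ satisfies $(u')^2=4u^3+C$ on $\mathbb C\setminus\mathcal L$ for some $C\in\mathbb C\setminus\{0\}$ if and only if $$\mathcal L=\{m\omega+n\omega e^{\pi i/3}: m,n\in\mathbb Z\}\qquad(*)$$ for some $\omega\in\mathbb C\setminus\{0\}$. (2) The function $u=\wp_{\mathcal L}$ satisfies $(u')^2=4u^3+C$ on $\mathbb C\setminus\mathcal L$ for some real $C>0$ if and only if $\mathcal L$ has the form $(*)$ for some $\omega\neq0$ with $\omega=|\omega|e^{\pi i/6}$. (3) Suppose that $\mathcal L$ has the form $(*)$ with $\omega\ne0$ and $\omega=|\omega|e^{\pi i/6}$. Then the real poles of $u=\wp_{\mathcal L}$ are exactly the integer multiples of $\sqrt3|\omega|$; $u$ takes only real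 values on $\mathbb R\setminus\mathcal L$; the zeros of $u$ in the fundamental parallelogram $\{s\omega+t\omega e^{-\pi i/3}:0\le s,t<1\}$, which has vertices $0$, $|\omega|e^{\pi i/6}$, $\sqrt3|\omega|$, $|\omega|e^{-\pi i/6}$, are exactly $\sqrt3|\omega|/3$ and $2\sqrt3|\omega|/3$; and $u$ is strictly increasing on the interval $(2\sqrt3|\omega|/3,\sqrt3|\omega|)$. -/

import Mathlib

/-- `u = ℘_L` satisfies the differential equation `(u')² = 4 u³ + C`. The equation is one between
meromorphic functions, so it is required at every point of `ℂ` that is not a pole, that is, off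
the period lattice. -/
def SatisfiesCubicODE (L : PeriodPair) (C : ℂ) : Prop :=
  ∀ z : ℂ, z ∉ L.lattice → (deriv L.weierstrassP z) ^ 2 = 4 * (L.weierstrassP z) ^ 3 + C

/-- The set `{m ω + n ω e^{π i / 3} : m, n ∈ ℤ}`. -/
def hexagonalLattice (ω : ℂ) : Set ℂ :=
  {z | ∃ m n : ℤ, z = m * ω + n * (ω * Complex.exp (Real.pi * Complex.I / 3))}

/-- The half-open parallelogram `{s a + t b : 0 ≤ s, t < 1}` spanned by `a` and `b`. -/
def fundamentalParallelogram (a b : ℂ) : Set ℂ :=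
  {z | ∃ s t : ℝ, s ∈ Set.Ico (0 : ℝ) 1 ∧ t ∈ Set.Ico (0 : ℝ) 1 ∧ z = s * a + t * b}

/-! Compared with (℘')² = 4℘³ - g₂℘ - g₃, the cubic equation with constant C says exactly g₂ = 0 and
g₃ = -C, because ℘ is unbounded. The passage to geometry is that (g₂, g₃) determines the lattice
(`lattice_eq_of_g₂_eq_of_g₃_eq`): the difference of two ℘-functions with the same invariants extends
analytically to 0 and solves a singular linear first-order equation with the single exponent -3, so
it vanishes, and the lattices are the sets of poles.

Let ε = e^{πi/3}. The invariants have degrees -4 and -6 and ε⁶ = 1, so g₂ = 0 gives εL = L, and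
division by a shortest period shows that L is hexagonal. Conversely εL = L forces g₂ = 0 because ε⁴
≠ 1; and g₃ ≠ 0 since L ≠ 2L.

With ω on the ray of argument π/6, L is stable under conjugation and √3|ω|/3 is a real zero of ℘,
being fixed modulo L by a rotation through 2π/3; there C = (℘')² > 0. A general hexagonal lattice is
rotated onto this one by some c, and positivity of both constants forces c⁶ = 1. The other zeros
follow from ℘(q) = ℘(p) ⇒ q ≡ ±p, and monotonicity from ℘'' = 6℘² ≥ 0 on the real axis. -/

open Filter Topology

/-! ### Uniqueness at a singular point of a first-order equation. -/

/-- A solution of `(z - a) d' A = d B` near a singular point `a` vanishes near `a` as soon as no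
exponent `n ≥ 0` satisfies the indicial equation `n A(a) = B(a)`. -/
theorem eventually_eq_zero_of_mul_deriv_eq {d A B : ℂ → ℂ} {a : ℂ} (hd : AnalyticAt ℂ d a)
    (hA : ContinuousAt A a) (hB : ContinuousAt B a)
    (h : ∀ᶠ z in 𝓝[≠] a, (z - a) * deriv d z * A z = d z * B z)
    (hne : ∀ n : ℕ, (n = 0 → d a ≠ 0) → n * A a ≠ B a) : ∀ᶠ z in 𝓝 a, d z = 0 := by
  by_contra hcon
  obtain ⟨n, g, hg, hga, hdg⟩ := hd.exists_eventuallyEq_pow_smul_nonzero_iff.mpr hcon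
  simp only [smul_eq_mul] at hdg
  refine hne n ?_ ?_
  · rintro rfl
    simpa [hdg.self_of_nhds] using hga
  -- Substitute d = (z - a)ⁿ g and cancel (z - a)ⁿ; the limit z → a is then the indicial equation
  -- times g(a) ≠ 0.
  have key : ∀ᶠ z in 𝓝[≠] a, (n * g z + (z - a) * deriv g z) * A z = g z * B z := by
    filter_upwards [h, hdg.filter_mono nhdsWithin_le_nhds,
      hdg.eventually_nhds.filter_mono nhdsWithin_le_nhds,
      hg.eventually_analyticAt.filter_mono nhdsWithin_le_nhds, self_mem_nhdsWithin]
      with z hz hdz hdz' hgz hza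
    have hza : z - a ≠ 0 := sub_ne_zero.mpr hza
    have hder : deriv d z = n * (z - a) ^ (n - 1) * g z + (z - a) ^ n * deriv g z := by
      rw [EventuallyEq.deriv_eq hdz']
      have h1 : HasDerivAt (fun w : ℂ => (w - a) ^ n) (n * (z - a) ^ (n - 1)) z := by
        simpa using ((hasDerivAt_id z).sub_const a).fun_pow n
      exact (h1.mul hgz.differentiableAt.hasDerivAt).deriv
    have hpow : (z - a) * (n * (z - a) ^ (n - 1)) = n * (z - a) ^ n := by
      cases n with
      | zero => simp
      | succ k => simp only [Nat.add_sub_cancel, pow_succ]; ring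
    rw [hder, hdz] at hz
    refine mul_left_cancel₀ (pow_ne_zero n hza) ?_
    linear_combination hz - g z * A z * hpow
  have hg' : ContinuousAt (deriv g) a := hg.deriv.continuousAt
  have hl : ContinuousAt (fun z => (n * g z + (z - a) * deriv g z) * A z) a := by
    have := hg.continuousAt
    fun_prop
  have hr : ContinuousAt (fun z => g z * B z) a := hg.continuousAt.mul hB
  have := tendsto_nhds_unique_of_eventuallyEq (hl.tendsto.mono_left nhdsWithin_le_nhds)
    (hr.tendsto.mono_left nhdsWithin_le_nhds) key
  refine mul_left_cancel₀ hga ?_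
  simp only [sub_self, zero_mul, add_zero] at this
  linear_combination this

/-! ### The invariants determine the lattice. -/

namespace PeriodPair

/-- Weierstrass functions that agree near one point, up to translations of the argument, have the
same poles. -/
theorem sub_add_mem_lattice_of_eventually_eq {L L' : PeriodPair} {a b c : ℂ}
    (h : ∀ᶠ z in 𝓝[≠] c, L.weierstrassP (z + a) = L'.weierstrassP (z + b)) {l : ℂ}
    (hl : l ∈ L.lattice) : l - a + b ∈ L'.lattice := by
  have h1 : Meromorphic fun z => L.weierstrassP (z + a) := fun z =>
    (L.meromorphic_weierstrassP (z + a)).comp_analyticAt (g := fun z => z + a) (by fun_prop)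
  have h2 : Meromorphic fun z => L'.weierstrassP (z + b) := fun z =>
    (L'.meromorphic_weierstrassP (z + b)).comp_analyticAt (g := fun z => z + b) (by fun_prop)
  have htop : meromorphicOrderAt (fun z => L.weierstrassP (z + a) - L'.weierstrassP (z + b))
      (l - a) = ⊤ := by
    -- Identity theorem: infinite order of the difference at `c` propagates to the pole `l - a`.
    by_contra hcon
    refine (h1.sub h2).exists_meromorphicOrderAt_ne_top_iff_forall.mp ⟨l - a, hcon⟩ c ?_
    rw [meromorphicOrderAt_eq_top_iff]
    filter_upwards [h] with z hz
    simp [hz]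
  rw [meromorphicOrderAt_eq_top_iff] at htop
  by_contra hmem
  have hcont : Tendsto (fun z => L'.weierstrassP (z + b)) (𝓝[≠] (l - a))
      (𝓝 (L'.weierstrassP (l - a + b))) := by
    have h3 : ContinuousAt L'.weierstrassP (l - a + b) :=
      (L'.analyticOnNhd_weierstrassP _ hmem).continuousAt
    have h4 : ContinuousAt (fun z : ℂ => z + b) (l - a) := by fun_prop
    exact (ContinuousAt.comp (f := fun z : ℂ => z + b) h3 h4).tendsto.mono_left
      nhdsWithin_le_nhds
  have hpole : Tendsto (fun z => ‖L.weierstrassP (z + a)‖) (𝓝[≠] (l - a)) atTop := by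
    have h3 := tendsto_cobounded_of_meromorphicOrderAt_neg (f := L.weierstrassP) (x := l)
      (by rw [L.order_weierstrassP l hl]; decide)
    rw [← tendsto_norm_atTop_iff_cobounded] at h3
    refine h3.comp (f := fun z => z + a) (tendsto_nhdsWithin_iff.mpr ⟨?_, ?_⟩)
    · have h4 : ContinuousAt (fun z : ℂ => z + a) (l - a) := by fun_prop
      simpa [ContinuousAt] using h4.tendsto.mono_left nhdsWithin_le_nhds
    · filter_upwards [self_mem_nhdsWithin] with z hz hz'
      exact hz (eq_sub_of_add_eq hz')
  refine not_tendsto_atTop_of_tendsto_nhds hcont.norm (hpole.congr' ?_)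
  filter_upwards [htop] with z hz
  rw [sub_eq_zero.mp hz]

/-- A period lattice is contained in any other one with the same invariants. -/
theorem lattice_le_of_g₂_eq_of_g₃_eq {L L' : PeriodPair} (h₂ : L.g₂ = L'.g₂) (h₃ : L.g₃ = L'.g₃) :
    L.lattice ≤ L'.lattice := by
  intro l hl
  suffices h : ∀ᶠ z in 𝓝 (0 : ℂ), L.weierstrassPExcept 0 z - L'.weierstrassPExcept 0 z = 0 by
    have := sub_add_mem_lattice_of_eventually_eq (L := L) (L' := L') (a := 0) (b := 0) (c := 0)
      ?_ hl
    · simpa using this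
    · filter_upwards [h.filter_mono nhdsWithin_le_nhds] with z hz
      have e := L.weierstrassPExcept_add 0 z
      have e' := L'.weierstrassPExcept_add 0 z
      simp only [ZeroMemClass.coe_zero] at e e'
      rw [add_zero, ← e, ← e', sub_eq_zero.mp hz]
  have hP := L.analyticAt_weierstrassPExcept 0
  have hQ := L'.analyticAt_weierstrassPExcept 0
  have hP' := L.analyticAt_derivWeierstrassPExcept 0
  have hQ' := L'.analyticAt_derivWeierstrassPExcept 0
  have cP := hP.continuousAt
  have cQ := hQ.continuousAt
  have cP' := hP'.continuousAt
  have cQ' := hQ'.continuousAt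
  -- Subtract the two cubic equations, factor both sides and multiply by z⁴, with z²℘ and z³℘'
  -- written through the regular parts. At 0 this gives A = -4 and B = 12, hence exponent -3.
  refine eventually_eq_zero_of_mul_deriv_eq
    (A := fun z => z ^ 3 * (L.derivWeierstrassPExcept 0 z + L'.derivWeierstrassPExcept 0 z) - 4)
    (B := fun z => 4 * ((z ^ 2 * L.weierstrassPExcept 0 z + 1) ^ 2 +
      (z ^ 2 * L.weierstrassPExcept 0 z + 1) * (z ^ 2 * L'.weierstrassPExcept 0 z + 1) +
      (z ^ 2 * L'.weierstrassPExcept 0 z + 1) ^ 2) - L.g₂ * z ^ 4)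
    (hP.sub hQ) (by fun_prop) (by fun_prop) ?_ ?_
  · have m := (L.compl_lattice_sdiff_singleton_mem_nhds 0)
    have m' := (L'.compl_lattice_sdiff_singleton_mem_nhds 0)
    filter_upwards [nhdsWithin_le_nhds m, nhdsWithin_le_nhds m', self_mem_nhdsWithin]
      with z hz hz' hz0
    have hz0 : z ≠ 0 := hz0
    have hd : deriv (fun z => L.weierstrassPExcept 0 z - L'.weierstrassPExcept 0 z) z =
        L.derivWeierstrassPExcept 0 z - L'.derivWeierstrassPExcept 0 z := by
      rw [deriv_fun_sub, L.eqOn_deriv_weierstrassPExcept_derivWeierstrassPExcept 0 hz,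
        L'.eqOn_deriv_weierstrassPExcept_derivWeierstrassPExcept 0 hz']
      · exact (L.analyticOnNhd_weierstrassPExcept 0 z hz).differentiableAt
      · exact (L'.analyticOnNhd_weierstrassPExcept 0 z hz').differentiableAt
    have n1 : z ∉ L.lattice := by simp_all
    have n2 : z ∉ L'.lattice := by simp_all
    have e1 := L.derivWeierstrassP_sq z n1
    have e2 := L'.derivWeierstrassP_sq z n2
    have a1 := L.weierstrassPExcept_def 0 z
    have a2 := L'.weierstrassPExcept_def 0 z
    have a3 := L.derivWeierstrassPExcept_def 0 z
    have a4 := L'.derivWeierstrassPExcept_def 0 z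
    simp only [ZeroMemClass.coe_zero, sub_zero] at a1 a2 a3 a4
    rw [← h₂, ← h₃] at e2
    simp only [sub_zero, hd, a1, a2, a3, a4]
    field_simp
    ring_nf
    linear_combination z ^ 6 * (e1 - e2)
  · intro n _ hn
    norm_num at hn
    have h5 : ((n + 3 : ℕ) : ℂ) = 0 := by push_cast; linear_combination -hn / 4
    norm_cast at h5

theorem lattice_eq_of_g₂_eq_of_g₃_eq {L L' : PeriodPair} (h₂ : L.g₂ = L'.g₂) (h₃ : L.g₃ = L'.g₃) :
    L.lattice = L'.lattice :=
  le_antisymm (lattice_le_of_g₂_eq_of_g₃_eq h₂ h₃) (lattice_le_of_g₂_eq_of_g₃_eq h₂.symm h₃.symm)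

/-! ### Fibres of ℘. -/

theorem hasDerivAt_weierstrassP (L : PeriodPair) {z : ℂ} (hz : z ∉ L.lattice) :
    HasDerivAt L.weierstrassP (L.derivWeierstrassP z) z := by
  rw [← L.deriv_weierstrassP]
  exact (L.analyticOnNhd_weierstrassP z hz).differentiableAt.hasDerivAt

/-- The translates by `p` and `q` solve the same cubic equation with the same initial data. For
their difference A(0) = 2℘'(p) ≠ 0 and B(0) = 0, so the only exponent is 0, which d(0) = 0 excludes.
Equal translates have equal poles. -/
theorem sub_mem_lattice_of_weierstrassP_eq_of_derivWeierstrassP_eq {L : PeriodPair} {p q : ℂ}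
    (hp : p ∉ L.lattice) (hq : q ∉ L.lattice) (h : L.weierstrassP q = L.weierstrassP p)
    (h' : L.derivWeierstrassP q = L.derivWeierstrassP p) (h0 : L.derivWeierstrassP p ≠ 0) :
    q - p ∈ L.lattice := by
  have an : ∀ x ∉ L.lattice, AnalyticAt ℂ (fun z => L.weierstrassP (z + x)) 0 := fun x hx =>
    AnalyticAt.fun_comp (g := L.weierstrassP) (f := fun z => z + x)
      (L.analyticOnNhd_weierstrassP _ (by simpa using hx)) (by fun_prop)
  have an' : ∀ x ∉ L.lattice, AnalyticAt ℂ (fun z => L.derivWeierstrassP (z + x)) 0 := fun x hx =>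
    AnalyticAt.fun_comp (g := L.derivWeierstrassP) (f := fun z => z + x)
      (L.analyticOnNhd_derivWeierstrassP _ (by simpa using hx)) (by fun_prop)
  have nm : ∀ x ∉ L.lattice, ∀ᶠ z in 𝓝[≠] (0 : ℂ), z + x ∉ L.lattice := fun x hx => by
    have c : ContinuousAt (fun z : ℂ => z + x) 0 := by fun_prop
    exact nhdsWithin_le_nhds (c.preimage_mem_nhds
      (L.isClosed_lattice.isOpen_compl.mem_nhds (by simpa using hx)))
  have c1 := (an p hp).continuousAt
  have c2 := (an q hq).continuousAt
  have c3 := (an' p hp).continuousAt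
  have c4 := (an' q hq).continuousAt
  have key := eventually_eq_zero_of_mul_deriv_eq (a := 0)
    (d := fun z => L.weierstrassP (z + p) - L.weierstrassP (z + q))
    (A := fun z => L.derivWeierstrassP (z + p) + L.derivWeierstrassP (z + q))
    (B := fun z => z * (4 * (L.weierstrassP (z + p) ^ 2 +
      L.weierstrassP (z + p) * L.weierstrassP (z + q) + L.weierstrassP (z + q) ^ 2) - L.g₂))
    ((an p hp).sub (an q hq)) (by fun_prop) (by fun_prop) ?_ ?_
  · have := sub_add_mem_lattice_of_eventually_eq (L := L) (L' := L) (a := p) (b := q) (c := 0)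
      ?_ L.lattice.zero_mem
    · convert this using 1; ring
    · filter_upwards [key.filter_mono nhdsWithin_le_nhds] with z hz using sub_eq_zero.mp hz
  · filter_upwards [nm p hp, nm q hq] with z hzp hzq
    have hd : HasDerivAt (fun z => L.weierstrassP (z + p) - L.weierstrassP (z + q))
        (L.derivWeierstrassP (z + p) - L.derivWeierstrassP (z + q)) z :=
      ((L.hasDerivAt_weierstrassP hzp).comp_add_const z p).sub
        ((L.hasDerivAt_weierstrassP hzq).comp_add_const z q)
    rw [hd.deriv]
    linear_combination z * (L.derivWeierstrassP_sq _ hzp - L.derivWeierstrassP_sq _ hzq)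
  · intro n hn hn'
    simp only [zero_add, zero_mul, h'] at hn'
    rcases mul_eq_zero.mp hn' with h1 | h1
    · exact hn (by exact_mod_cast h1) (by simp [h])
    · exact h0 (by linear_combination h1 / 2)

/-- `℘(q) = ℘(p)` only if `q ≡ ± p` modulo the periods (for `p` not a half period). -/
theorem sub_mem_or_add_mem_lattice_of_weierstrassP_eq {L : PeriodPair} {p q : ℂ}
    (hp : p ∉ L.lattice) (hq : q ∉ L.lattice) (h : L.weierstrassP q = L.weierstrassP p)
    (h0 : L.derivWeierstrassP p ≠ 0) : q - p ∈ L.lattice ∨ q + p ∈ L.lattice := by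
  have hsq : L.derivWeierstrassP q ^ 2 = L.derivWeierstrassP p ^ 2 := by
    rw [L.derivWeierstrassP_sq _ hp, L.derivWeierstrassP_sq _ hq, h]
  rcases sq_eq_sq_iff_eq_or_eq_neg.mp hsq with h' | h'
  · exact .inl (sub_mem_lattice_of_weierstrassP_eq_of_derivWeierstrassP_eq hp hq h h' h0)
  · refine .inr ?_
    simpa using sub_mem_lattice_of_weierstrassP_eq_of_derivWeierstrassP_eq (L := L) (p := -p)
      (by simpa using hp) hq (by simpa using h) (by simpa using h') (by simpa using h0)

/-! ### Homogeneity and complex conjugation. -/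

/-- The period pair `(c ω₁, c ω₂)`, whose lattice is `c` times that of `L`. -/
@[simps] noncomputable def scale (L : PeriodPair) (c : ℂ) (hc : c ≠ 0) : PeriodPair where
  ω₁ := c * L.ω₁
  ω₂ := c * L.ω₂
  indep := by
    refine LinearIndependent.pair_iff.mpr fun s t h => LinearIndependent.pair_iff.mp L.indep s t ?_
    refine mul_left_cancel₀ hc ?_
    simp only [Complex.real_smul] at h ⊢
    linear_combination h

theorem mul_mem_lattice_scale {L : PeriodPair} {c : ℂ} (hc : c ≠ 0) (z : ℂ) :
    c * z ∈ (L.scale c hc).lattice ↔ z ∈ L.lattice := by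
  simp only [mem_lattice, scale_ω₁, scale_ω₂]
  refine exists_congr fun m => exists_congr fun n => ?_
  refine Iff.trans ?_ (mul_right_inj' hc)
  ring_nf

/-- Multiplication by `c` as a bijection between proportional lattices. -/
noncomputable def mulEquiv {L L' : PeriodPair} {c : ℂ} (hc : c ≠ 0)
    (h : ∀ z, c * z ∈ L'.lattice ↔ z ∈ L.lattice) : L.lattice ≃ L'.lattice :=
  (Equiv.mulLeft₀ c hc).subtypeEquiv fun z => (h z).symm

theorem coe_mulEquiv {L L' : PeriodPair} {c : ℂ} (hc : c ≠ 0)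
    (h : ∀ z, c * z ∈ L'.lattice ↔ z ∈ L.lattice) (l : L.lattice) :
    (mulEquiv hc h l : ℂ) = c * l := rfl

theorem weierstrassP_mul {L L' : PeriodPair} {c : ℂ} (hc : c ≠ 0)
    (h : ∀ z, c * z ∈ L'.lattice ↔ z ∈ L.lattice) (z : ℂ) :
    L'.weierstrassP (c * z) = (c ^ 2)⁻¹ * L.weierstrassP z := by
  simp only [weierstrassP]
  -- The term l = 0 needs no separate treatment: its 1 / l² is 0 by convention.
  rw [← (mulEquiv hc h).tsum_eq, ← tsum_mul_left]
  congr with l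
  rw [coe_mulEquiv, ← mul_sub, mul_pow, mul_pow]
  simp only [one_div, mul_inv]
  ring

theorem G_eq_of_mul {L L' : PeriodPair} {c : ℂ} (hc : c ≠ 0)
    (h : ∀ z, c * z ∈ L'.lattice ↔ z ∈ L.lattice) (n : ℕ) : L'.G n = (c ^ n)⁻¹ * L.G n := by
  simp only [G]
  rw [← (mulEquiv hc h).tsum_eq, ← tsum_mul_left]
  congr with l
  rw [coe_mulEquiv, mul_pow, mul_inv]

theorem g₂_eq_of_mul {L L' : PeriodPair} {c : ℂ} (hc : c ≠ 0)
    (h : ∀ z, c * z ∈ L'.lattice ↔ z ∈ L.lattice) : L'.g₂ = (c ^ 4)⁻¹ * L.g₂ := by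
  rw [g₂, g₂, G_eq_of_mul hc h]; ring

theorem g₃_eq_of_mul {L L' : PeriodPair} {c : ℂ} (hc : c ≠ 0)
    (h : ∀ z, c * z ∈ L'.lattice ↔ z ∈ L.lattice) : L'.g₃ = (c ^ 6)⁻¹ * L.g₃ := by
  rw [g₃, g₃, G_eq_of_mul hc h]; ring

theorem weierstrassP_conj {L : PeriodPair}
    (h : ∀ z, (starRingEnd ℂ) z ∈ L.lattice ↔ z ∈ L.lattice) (z : ℂ) :
    L.weierstrassP ((starRingEnd ℂ) z) = (starRingEnd ℂ) (L.weierstrassP z) := by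
  let e : L.lattice ≃ L.lattice :=
    (starRingAut (R := ℂ)).toEquiv.subtypeEquiv fun z => (h z).symm
  have he : ∀ l, (e l : ℂ) = (starRingEnd ℂ) l := fun l => rfl
  simp only [weierstrassP]
  rw [← e.tsum_eq, Complex.conj_tsum]
  congr with l
  simp [he]

/-- The lattice `2 L` differs from `L`, so the invariants cannot both vanish. -/
theorem g₃_ne_zero_of_g₂_eq_zero {L : PeriodPair} (h : L.g₂ = 0) : L.g₃ ≠ 0 := by
  intro h'
  have hs := mul_mem_lattice_scale (L := L) (two_ne_zero (α := ℂ))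
  have hL : L.lattice = (L.scale 2 two_ne_zero).lattice :=
    lattice_eq_of_g₂_eq_of_g₃_eq (by rw [g₂_eq_of_mul two_ne_zero hs, h, mul_zero])
      (by rw [g₃_eq_of_mul two_ne_zero hs, h', mul_zero])
  refine L.ω₁_div_two_notMem_lattice ((hs _).mp ?_)
  rw [← hL, mul_div_cancel₀ _ two_ne_zero]
  exact L.ω₁_mem_lattice

end PeriodPair

/-! ### The cubic equation in terms of the invariants. -/

open PeriodPair

theorem satisfiesCubicODE_iff {L : PeriodPair} {C : ℂ} :
    SatisfiesCubicODE L C ↔ L.g₂ = 0 ∧ L.g₃ = -C := by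
  constructor
  · intro h
    -- If g₂ ≠ 0, this would make ℘ constant off the lattice, against its pole at 0.
    have key : ∀ z ∉ L.lattice, L.g₂ * L.weierstrassP z = -C - L.g₃ := fun z hz => by
      have h1 := h z hz
      rw [deriv_weierstrassP, L.derivWeierstrassP_sq z hz] at h1
      linear_combination -h1
    have h2 : L.g₂ = 0 := by
      by_contra hne
      have ht := tendsto_cobounded_of_meromorphicOrderAt_neg (f := L.weierstrassP) (x := 0)
        (by rw [L.order_weierstrassP 0 L.lattice.zero_mem]; decide)
      rw [← tendsto_norm_atTop_iff_cobounded] at ht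
      refine not_tendsto_atTop_of_tendsto_nhds
        (tendsto_const_nhds (x := ‖(-C - L.g₃) / L.g₂‖)) (ht.congr' ?_)
      filter_upwards [nhdsWithin_le_nhds (L.compl_lattice_sdiff_singleton_mem_nhds 0),
        self_mem_nhdsWithin] with z hz hz0
      rw [← key z (by simp_all), mul_div_cancel_left₀ _ hne]
    refine ⟨h2, ?_⟩
    have := key _ L.ω₁_div_two_notMem_lattice
    rw [h2] at this
    linear_combination this
  · rintro ⟨h2, h3⟩ z hz
    rw [deriv_weierstrassP, L.derivWeierstrassP_sq z hz, h2, h3]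
    ring

/-! ### Sixth roots of unity and hexagonal lattices. -/

theorem exp_pi_mul_I_div_three :
    Complex.exp (Real.pi * Complex.I / 3) = 1 / 2 + √3 / 2 * Complex.I := by
  rw [show (Real.pi * Complex.I / 3 : ℂ) = ((Real.pi / 3 : ℝ) : ℂ) * Complex.I by push_cast; ring,
    Complex.exp_mul_I, ← Complex.ofReal_cos, ← Complex.ofReal_sin, Real.cos_pi_div_three,
    Real.sin_pi_div_three]
  push_cast; ring

theorem exp_neg_pi_mul_I_div_three :
    Complex.exp (-(Real.pi * Complex.I / 3)) = 1 / 2 - √3 / 2 * Complex.I := by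
  rw [show (-(Real.pi * Complex.I / 3) : ℂ) = ((-(Real.pi / 3) : ℝ) : ℂ) * Complex.I by
    push_cast; ring, Complex.exp_mul_I, ← Complex.ofReal_cos, ← Complex.ofReal_sin, Real.cos_neg,
    Real.sin_neg, Real.cos_pi_div_three, Real.sin_pi_div_three]
  push_cast; ring

theorem exp_pi_mul_I_div_six :
    Complex.exp (Real.pi * Complex.I / 6) = √3 / 2 + 1 / 2 * Complex.I := by
  rw [show (Real.pi * Complex.I / 6 : ℂ) = ((Real.pi / 6 : ℝ) : ℂ) * Complex.I by push_cast; ring,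
    Complex.exp_mul_I, ← Complex.ofReal_cos, ← Complex.ofReal_sin, Real.cos_pi_div_six,
    Real.sin_pi_div_six]
  push_cast; ring

theorem ofReal_sqrt_three_sq : ((√3 : ℝ) : ℂ) ^ 2 = 3 := by
  norm_cast
  exact Real.sq_sqrt (by norm_num)

theorem exp_pi_mul_I_div_three_sq :
    Complex.exp (Real.pi * Complex.I / 3) ^ 2 = Complex.exp (Real.pi * Complex.I / 3) - 1 := by
  rw [exp_pi_mul_I_div_three]
  linear_combination (Complex.I ^ 2 / 4) * ofReal_sqrt_three_sq + (3 / 4) * Complex.I_sq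

theorem exp_pi_mul_I_div_three_pow_four :
    Complex.exp (Real.pi * Complex.I / 3) ^ 4 = -Complex.exp (Real.pi * Complex.I / 3) := by
  set ε := Complex.exp (Real.pi * Complex.I / 3)
  linear_combination (ε ^ 2 + ε) * exp_pi_mul_I_div_three_sq

theorem exp_pi_mul_I_div_three_pow_six :
    Complex.exp (Real.pi * Complex.I / 3) ^ 6 = 1 := by
  set ε := Complex.exp (Real.pi * Complex.I / 3)
  linear_combination ε ^ 2 * exp_pi_mul_I_div_three_pow_four -
    (ε + 1) * exp_pi_mul_I_div_three_sq

theorem exp_mul_mem_hexagonalLattice {ω z : ℂ} :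
    Complex.exp (Real.pi * Complex.I / 3) * z ∈ hexagonalLattice ω ↔ z ∈ hexagonalLattice ω := by
  have hsq := exp_pi_mul_I_div_three_sq
  have h0 := Complex.exp_ne_zero (Real.pi * Complex.I / 3)
  simp only [hexagonalLattice, Set.mem_ofPred_eq]
  set ε := Complex.exp (Real.pi * Complex.I / 3)
  constructor
  · rintro ⟨m, n, h⟩
    refine ⟨m + n, -m, mul_left_cancel₀ h0 ?_⟩
    rw [h]
    push_cast
    linear_combination m * ω * hsq
  · rintro ⟨m, n, rfl⟩
    refine ⟨-n, m + n, ?_⟩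
    push_cast
    linear_combination n * ω * hsq

theorem neg_mem_hexagonalLattice {ω z : ℂ} :
    -z ∈ hexagonalLattice ω ↔ z ∈ hexagonalLattice ω := by
  have : ∀ z, z ∈ hexagonalLattice ω → -z ∈ hexagonalLattice ω := by
    rintro _ ⟨m, n, rfl⟩
    exact ⟨-m, -n, by push_cast; ring⟩
  exact ⟨fun h => by simpa using this _ h, this z⟩

theorem mul_mem_hexagonalLattice_mul {c ω z : ℂ} (hc : c ≠ 0) :
    c * z ∈ hexagonalLattice (c * ω) ↔ z ∈ hexagonalLattice ω := by
  simp only [hexagonalLattice, Set.mem_ofPred_eq]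
  refine exists_congr fun m => exists_congr fun n => ?_
  refine Iff.trans ?_ (mul_right_inj' hc)
  ring_nf

/-- A hexagonal lattice is invariant under multiplication by every sixth root of unity. -/
theorem mul_mem_hexagonalLattice_of_pow_six {ζ ω z : ℂ} (hζ : ζ ^ 6 = 1) :
    ζ * z ∈ hexagonalLattice ω ↔ z ∈ hexagonalLattice ω := by
  have hsq := exp_pi_mul_I_div_three_sq
  set ε := Complex.exp (Real.pi * Complex.I / 3) with hε
  -- The sixth roots of unity are ±1, ±ε, ±ε²; this is the factorization of ζ⁶ - 1.
  have hprod : (ζ - 1) * ((ζ + 1) * ((ζ - ε) * ((ζ - ε ^ 2) * ((ζ + ε) * (ζ + ε ^ 2))))) = 0 := by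
    have h4 : ε ^ 4 = -ε := exp_pi_mul_I_div_three_pow_four
    have h6 : ε ^ 6 = 1 := exp_pi_mul_I_div_three_pow_six
    linear_combination hζ - (ζ ^ 2 - 1) * ζ ^ 2 * (hsq + h4) + (ζ ^ 2 - 1) * h6
  simp only [mul_eq_zero] at hprod
  have e1 : ∀ z, ε * z ∈ hexagonalLattice ω ↔ z ∈ hexagonalLattice ω := fun z =>
    exp_mul_mem_hexagonalLattice
  have e2 : ∀ z, ε ^ 2 * z ∈ hexagonalLattice ω ↔ z ∈ hexagonalLattice ω := fun z => by
    rw [pow_two, mul_assoc, e1, e1]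
  rcases hprod with h | h | h | h | h | h
  · rw [sub_eq_zero.mp h, one_mul]
  · rw [eq_neg_of_add_eq_zero_left h, neg_one_mul, neg_mem_hexagonalLattice]
  · rw [sub_eq_zero.mp h, e1]
  · rw [sub_eq_zero.mp h, e2]
  · rw [eq_neg_of_add_eq_zero_left h, neg_mul, neg_mem_hexagonalLattice, e1]
  · rw [eq_neg_of_add_eq_zero_left h, neg_mul, neg_mem_hexagonalLattice, e2]

/-- Only finitely many periods lie in the closed disc of radius |ω₁|, so a minimum over the nonzero
ones exists. -/
theorem PeriodPair.exists_shortest (L : PeriodPair) :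
    ∃ ω ∈ L.lattice, ω ≠ 0 ∧ ∀ z ∈ L.lattice, ‖z‖ < ‖ω‖ → z = 0 := by
  have hfin : ((L.lattice : Set ℂ) ∩ Metric.closedBall 0 ‖L.ω₁‖).Finite := by
    rw [Set.inter_comm, L.lattice_eq_span_range_basis]
    exact ZSpan.setFinite_inter L.basis Metric.isBounded_closedBall
  have h0 : L.ω₁ ≠ 0 := by
    intro h
    have := L.indep.ne_zero 0
    simp [h] at this
  obtain ⟨ω, hω, hmin⟩ := Set.exists_min_image
    (((L.lattice : Set ℂ) ∩ Metric.closedBall 0 ‖L.ω₁‖) \ {0}) (fun z => ‖z‖) hfin.sdiff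
    ⟨L.ω₁, ⟨L.ω₁_mem_lattice, by simp⟩, by simpa using h0⟩
  refine ⟨ω, hω.1.1, hω.2, fun z hz hlt => ?_⟩
  by_contra hz0
  have hω' : ‖ω‖ ≤ ‖L.ω₁‖ := by simpa using hω.1.2
  exact (hmin z ⟨⟨hz, by simpa using hlt.le.trans hω'⟩, hz0⟩).not_gt hlt

/-- A lattice invariant under rotation by `π / 3` is hexagonal. -/
theorem exists_lattice_eq_hexagonalLattice {L : PeriodPair}
    (h : ∀ z ∈ L.lattice, Complex.exp (Real.pi * Complex.I / 3) * z ∈ L.lattice) :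
    ∃ ω : ℂ, ω ≠ 0 ∧ (L.lattice : Set ℂ) = hexagonalLattice ω := by
  obtain ⟨ω, hω, hω0, hmin⟩ := L.exists_shortest
  refine ⟨ω, hω0, Set.Subset.antisymm (fun z hz => ?_) ?_⟩
  · have hs3 : (0 : ℝ) < √3 := by positivity
    have h3 : (√3 : ℝ) ^ 2 = 3 := Real.sq_sqrt (by norm_num)
    have hs3' : ((√3 : ℝ) : ℂ) ≠ 0 := by exact_mod_cast hs3.ne'
    -- Real coordinates of z / ω in the basis 1, ε.
    set t : ℝ := 2 * (z / ω).im / √3 with ht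
    set s : ℝ := (z / ω).re - t / 2 with hs
    have hz' : z = (s + t * Complex.exp (Real.pi * Complex.I / 3)) * ω := by
      rw [exp_pi_mul_I_div_three, ← div_eq_iff hω0]
      apply Complex.ext
      · simp [hs]; ring
      · simp [ht]; field_simp
    refine ⟨round s, round t, ?_⟩
    have hmem : z - (round s * ω + round t * (Complex.exp (Real.pi * Complex.I / 3) * ω)) ∈
        L.lattice := by
      refine L.lattice.sub_mem hz (L.lattice.add_mem ?_ ?_)
      · simpa using L.lattice.smul_mem (round s) hω
      · simpa using L.lattice.smul_mem (round t) (h ω hω)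
    have := hmin _ hmem ?_
    · linear_combination this
    · set a : ℝ := s - round s with ha
      set b : ℝ := t - round t with hb
      have hab : z - (round s * ω + round t * (Complex.exp (Real.pi * Complex.I / 3) * ω)) =
          (a + b * Complex.exp (Real.pi * Complex.I / 3)) * ω := by
        rw [hz', ha, hb]; push_cast; ring
      rw [hab, norm_mul]
      refine mul_lt_of_lt_one_left (norm_pos_iff.mpr hω0) ?_
      obtain ⟨ha1, ha2⟩ := abs_le.mp (abs_sub_round s)
      obtain ⟨hb1, hb2⟩ := abs_le.mp (abs_sub_round t)
      rw [← ha] at ha1 ha2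
      rw [← hb] at hb1 hb2
      rw [← sq_lt_one_iff₀ (norm_nonneg _), ← Complex.normSq_eq_norm_sq, exp_pi_mul_I_div_three,
        Complex.normSq_apply]
      simp
      -- The remainder of rounding satisfies |a + bε|² = a² + ab + b² ≤ 3/4, so it is shorter than ω
      -- and must be 0.
      have e : (a + b * 2⁻¹) * (a + b * 2⁻¹) + b * (√3 / 2) * (b * (√3 / 2)) =
          a * a + a * b + b * b := by linear_combination b ^ 2 / 4 * h3
      rw [e]
      nlinarith [mul_nonneg (sub_nonneg.mpr ha1) (sub_nonneg.mpr ha2),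
        mul_nonneg (sub_nonneg.mpr hb1) (sub_nonneg.mpr hb2), sq_nonneg (a - b)]
  · rintro _ ⟨m, n, rfl⟩
    refine L.lattice.add_mem ?_ ?_
    · simpa using L.lattice.smul_mem m hω
    · simpa [mul_comm ω] using L.lattice.smul_mem n (h ω hω)

/-! ### Reality, poles and the second derivative of ℘. -/

namespace PeriodPair

theorem derivWeierstrassP_conj {L : PeriodPair}
    (h : ∀ z, (starRingEnd ℂ) z ∈ L.lattice ↔ z ∈ L.lattice) (z : ℂ) :
    L.derivWeierstrassP ((starRingEnd ℂ) z) = (starRingEnd ℂ) (L.derivWeierstrassP z) := by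
  let e : L.lattice ≃ L.lattice :=
    (starRingAut (R := ℂ)).toEquiv.subtypeEquiv fun z => (h z).symm
  have he : ∀ l, (e l : ℂ) = (starRingEnd ℂ) l := fun l => rfl
  simp only [derivWeierstrassP]
  rw [← e.tsum_eq, map_neg, Complex.conj_tsum]
  congr with l
  simp [he, Complex.conj_ofNat]

theorem im_weierstrassP_ofReal {L : PeriodPair}
    (h : ∀ z, (starRingEnd ℂ) z ∈ L.lattice ↔ z ∈ L.lattice) (x : ℝ) :
    (L.weierstrassP x).im = 0 := by
  rw [← Complex.conj_eq_iff_im, ← weierstrassP_conj h, Complex.conj_ofReal]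

theorem im_derivWeierstrassP_ofReal {L : PeriodPair}
    (h : ∀ z, (starRingEnd ℂ) z ∈ L.lattice ↔ z ∈ L.lattice) (x : ℝ) :
    (L.derivWeierstrassP x).im = 0 := by
  rw [← Complex.conj_eq_iff_im, ← derivWeierstrassP_conj h, Complex.conj_ofReal]

theorem meromorphicOrderAt_weierstrassP_neg_iff {L : PeriodPair} {z : ℂ} :
    meromorphicOrderAt L.weierstrassP z < 0 ↔ z ∈ L.lattice := by
  refine ⟨fun h => ?_, fun h => by rw [L.order_weierstrassP z h]; decide⟩
  by_contra hz
  exact h.not_ge (L.analyticOnNhd_weierstrassP z hz).meromorphicOrderAt_nonneg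

theorem isPreconnected_compl_lattice (L : PeriodPair) :
    IsPreconnected ((L.lattice : Set ℂ)ᶜ) := by
  have hc : (L.lattice : Set ℂ).Countable := by
    have : Countable L.lattice := L.latticeEquivProd.toEquiv.countable_iff.mpr inferInstance
    exact Set.to_countable _
  exact (hc.isPathConnected_compl_of_one_lt_rank (by simp)).isConnected.isPreconnected

/-- `℘'' = 6 ℘² - g₂ / 2`. -/
theorem hasDerivAt_derivWeierstrassP {L : PeriodPair} {p : ℂ} (hp : p ∉ L.lattice)
    (hp' : L.derivWeierstrassP p ≠ 0) {z : ℂ} (hz : z ∉ L.lattice) :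
    HasDerivAt L.derivWeierstrassP (6 * L.weierstrassP z ^ 2 - L.g₂ / 2) z := by
  have hP := L.analyticOnNhd_weierstrassP
  have hP' := L.analyticOnNhd_derivWeierstrassP
  -- Differentiating the cubic equation gives this only up to the factor ℘'; it is cancelled because
  -- the complement of the countable lattice is connected and ℘' does not vanish identically.
  have hprod : ∀ w ∈ (L.lattice : Set ℂ)ᶜ, L.derivWeierstrassP w *
      (deriv L.derivWeierstrassP w - (6 * L.weierstrassP w ^ 2 - L.g₂ / 2)) = 0 := fun w hw => by
    have h1 := (L.hasDerivAt_weierstrassP hw)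
    have h2 := (hP' w hw).differentiableAt.hasDerivAt
    have h3 := h2.fun_pow 2
    have h4 := (((h1.fun_pow 3).const_mul 4).sub (h1.const_mul L.g₂)).sub_const L.g₃
    have h5 := (h4.congr_of_eventuallyEq ?_).unique h3
    · push_cast at h5
      linear_combination -h5 / 2
    · filter_upwards [L.isClosed_lattice.isOpen_compl.mem_nhds hw] with v hv
      rw [L.derivWeierstrassP_sq v hv]
      simp
  have hor := AnalyticOnNhd.eq_zero_or_eq_zero_of_mul_eq_zero hP'
    (hP'.deriv.sub ((analyticOnNhd_const.mul (hP.pow 2)).sub analyticOnNhd_const)) hprod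
    L.isPreconnected_compl_lattice
  rcases hor with h | h
  · exact absurd (h p hp) hp'
  · have hz' : deriv L.derivWeierstrassP z = 6 * L.weierstrassP z ^ 2 - L.g₂ / 2 :=
      sub_eq_zero.mp (h z hz)
    rw [← hz']
    exact (hP' z hz).differentiableAt.hasDerivAt

end PeriodPair

/-! ### Hexagonal symmetry and the invariants. -/

section Hexagonal

variable {L : PeriodPair} {ω : ℂ}

theorem mem_lattice_iff_of_hexagonal (hL : (L.lattice : Set ℂ) = hexagonalLattice ω) (z : ℂ) :
    z ∈ L.lattice ↔ z ∈ hexagonalLattice ω := by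
  rw [← hL, SetLike.mem_coe]

theorem exp_mul_mem_lattice_iff_of_hexagonal (hL : (L.lattice : Set ℂ) = hexagonalLattice ω)
    (z : ℂ) : Complex.exp (Real.pi * Complex.I / 3) * z ∈ L.lattice ↔ z ∈ L.lattice := by
  simp only [mem_lattice_iff_of_hexagonal hL, exp_mul_mem_hexagonalLattice]

theorem exp_pi_mul_I_div_three_pow_four_ne_one :
    Complex.exp (Real.pi * Complex.I / 3) ^ 4 ≠ 1 := by
  rw [exp_pi_mul_I_div_three_pow_four, exp_pi_mul_I_div_three]
  intro h
  have := congrArg Complex.re h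
  norm_num at this

/-- Invariance under ε gives g₂ = ε⁻⁴ g₂. -/
theorem g₂_eq_zero_of_hexagonal (hL : (L.lattice : Set ℂ) = hexagonalLattice ω) : L.g₂ = 0 := by
  have h := g₂_eq_of_mul (Complex.exp_ne_zero _) (exp_mul_mem_lattice_iff_of_hexagonal hL)
  by_contra h0
  refine exp_pi_mul_I_div_three_pow_four_ne_one (inv_eq_one.mp (mul_right_cancel₀ h0 ?_))
  rw [one_mul, ← h]

/-- The points fixed modulo the lattice by a rotation through `2 π / 3` are zeros of `℘`. -/
theorem weierstrassP_eq_zero_of_hexagonal (hL : (L.lattice : Set ℂ) = hexagonalLattice ω) {z : ℂ}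
    (hz : Complex.exp (Real.pi * Complex.I / 3) ^ 2 * z - z ∈ L.lattice) :
    L.weierstrassP z = 0 := by
  have hinv : ∀ w, Complex.exp (Real.pi * Complex.I / 3) ^ 2 * w ∈ L.lattice ↔ w ∈ L.lattice :=
    fun w => by
      rw [pow_two, mul_assoc, exp_mul_mem_lattice_iff_of_hexagonal hL,
        exp_mul_mem_lattice_iff_of_hexagonal hL]
  have h := weierstrassP_mul (pow_ne_zero 2 (Complex.exp_ne_zero _)) hinv z
  have hper := L.weierstrassP_add_coe z ⟨_, hz⟩
  simp only [add_sub_cancel] at hper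
  rw [hper, ← pow_mul] at h
  by_contra h0
  refine exp_pi_mul_I_div_three_pow_four_ne_one (inv_eq_one.mp (mul_right_cancel₀ h0 ?_))
  rw [one_mul, ← h]

/-- The lattices L and εL share g₂ = 0 and, as ε⁶ = 1, also g₃; hence they coincide. -/
theorem exists_hexagonal_of_satisfiesCubicODE {C : ℂ} (h : SatisfiesCubicODE L C) :
    ∃ ω : ℂ, ω ≠ 0 ∧ (L.lattice : Set ℂ) = hexagonalLattice ω := by
  obtain ⟨h₂, -⟩ := satisfiesCubicODE_iff.mp h
  have hε := Complex.exp_ne_zero (Real.pi * Complex.I / 3)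
  have hs := mul_mem_lattice_scale (L := L) hε
  have hL : L.lattice = (L.scale _ hε).lattice :=
    lattice_eq_of_g₂_eq_of_g₃_eq (by rw [g₂_eq_of_mul hε hs, h₂, mul_zero])
      (by rw [g₃_eq_of_mul hε hs, exp_pi_mul_I_div_three_pow_six, inv_one, one_mul])
  refine exists_lattice_eq_hexagonalLattice fun z hz => ?_
  rw [hL]
  exact (hs z).mpr hz

theorem satisfiesCubicODE_of_hexagonal (hL : (L.lattice : Set ℂ) = hexagonalLattice ω) :
    SatisfiesCubicODE L (-L.g₃) :=
  satisfiesCubicODE_iff.mpr ⟨g₂_eq_zero_of_hexagonal hL, (neg_neg _).symm⟩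

theorem ofReal_norm_mul_exp (harg : ω = (‖ω‖ : ℂ) * Complex.exp (Real.pi * Complex.I / 6)) :
    ω = ‖ω‖ * (√3 / 2 + 1 / 2 * Complex.I) := by
  rw [← exp_pi_mul_I_div_six]; exact harg

theorem mul_exp_pi_mul_I_div_three
    (harg : ω = (‖ω‖ : ℂ) * Complex.exp (Real.pi * Complex.I / 6)) :
    ω * Complex.exp (Real.pi * Complex.I / 3) = ‖ω‖ * Complex.I := by
  have h := ofReal_norm_mul_exp harg
  rw [exp_pi_mul_I_div_three]
  generalize (‖ω‖ : ℂ) = r at h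
  rw [h]
  linear_combination r * Complex.I / 4 * ofReal_sqrt_three_sq + r * √3 / 4 * Complex.I_sq

theorem conj_mem_hexagonalLattice
    (harg : ω = (‖ω‖ : ℂ) * Complex.exp (Real.pi * Complex.I / 6)) (z : ℂ) :
    (starRingEnd ℂ) z ∈ hexagonalLattice ω ↔ z ∈ hexagonalLattice ω := by
  have key : ∀ z, z ∈ hexagonalLattice ω → (starRingEnd ℂ) z ∈ hexagonalLattice ω := by
    rintro _ ⟨m, n, rfl⟩
    -- Conjugation sends ω to ω - ωε and negates ωε = i|ω|.
    refine ⟨m, -(m + n), ?_⟩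
    have h1 := mul_exp_pi_mul_I_div_three harg
    have h2 := ofReal_norm_mul_exp harg
    rw [h1]
    have h3 : (starRingEnd ℂ) ω = ω - ‖ω‖ * Complex.I := by
      generalize (‖ω‖ : ℝ) = r at h2
      rw [h2]
      simp [Complex.conj_ofNat]
      ring
    simp only [map_add, map_mul, Complex.conj_I, Complex.conj_ofReal, h3, map_intCast]
    push_cast
    ring
  exact ⟨fun h => by simpa using key _ h, key z⟩

theorem ofReal_mem_hexagonalLattice (hω : ω ≠ 0)
    (harg : ω = (‖ω‖ : ℂ) * Complex.exp (Real.pi * Complex.I / 6)) (x : ℝ) :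
    (x : ℂ) ∈ hexagonalLattice ω ↔ ∃ k : ℤ, x = k * (√3 * ‖ω‖) := by
  have hr := norm_pos_iff.mpr hω
  have h1 := mul_exp_pi_mul_I_div_three harg
  have h2 := ofReal_norm_mul_exp harg
  simp only [hexagonalLattice, Set.mem_ofPred_eq, h1]
  generalize ‖ω‖ = r at *
  rw [h2]
  constructor
  · rintro ⟨m, n, h⟩
    have hre := congrArg Complex.re h
    have him := congrArg Complex.im h
    simp at hre him
    have hmn : (m : ℝ) = -2 * n :=
      mul_left_cancel₀ hr.ne' (by linear_combination -2 * him)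
    refine ⟨-n, ?_⟩
    push_cast
    rw [hre, hmn]
    ring
  · rintro ⟨k, rfl⟩
    refine ⟨2 * k, -k, ?_⟩
    push_cast
    ring

end Hexagonal

/-! ### The lattice in standard position. -/

section RealHexagonal

variable {L : PeriodPair} {ω : ℂ}

theorem ofReal_mem_lattice_iff (hω : ω ≠ 0)
    (harg : ω = (‖ω‖ : ℂ) * Complex.exp (Real.pi * Complex.I / 6))
    (hL : (L.lattice : Set ℂ) = hexagonalLattice ω) (x : ℝ) :
    (x : ℂ) ∈ L.lattice ↔ ∃ k : ℤ, x = k * (√3 * ‖ω‖) := by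
  rw [mem_lattice_iff_of_hexagonal hL, ofReal_mem_hexagonalLattice hω harg]

theorem conj_mem_lattice_iff
    (harg : ω = (‖ω‖ : ℂ) * Complex.exp (Real.pi * Complex.I / 6))
    (hL : (L.lattice : Set ℂ) = hexagonalLattice ω) (z : ℂ) :
    (starRingEnd ℂ) z ∈ L.lattice ↔ z ∈ L.lattice := by
  simp only [mem_lattice_iff_of_hexagonal hL, conj_mem_hexagonalLattice harg]

/-- The open interval between two consecutive real poles. -/
theorem ofReal_notMem_lattice (hω : ω ≠ 0)
    (harg : ω = (‖ω‖ : ℂ) * Complex.exp (Real.pi * Complex.I / 6))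
    (hL : (L.lattice : Set ℂ) = hexagonalLattice ω) {x : ℝ} (hx : x ∈ Set.Ioo 0 (√3 * ‖ω‖)) :
    (x : ℂ) ∉ L.lattice := by
  rw [ofReal_mem_lattice_iff hω harg hL]
  rintro ⟨k, rfl⟩
  have hpos : 0 < √3 * ‖ω‖ := hx.1.trans hx.2
  have h1 : (0 : ℝ) < k := pos_of_mul_pos_left hx.1 hpos.le
  have h2 : (k : ℝ) < 1 := by
    by_contra hk
    exact hx.2.not_ge (le_mul_of_one_le_left hpos.le (not_lt.mp hk))
  norm_cast at h1 h2
  omega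

theorem sqrt_three_mul_norm_pos (hω : ω ≠ 0) : 0 < √3 * ‖ω‖ :=
  mul_pos (by positivity) (norm_pos_iff.mpr hω)

theorem third_mem_Ioo (hω : ω ≠ 0) : √3 * ‖ω‖ / 3 ∈ Set.Ioo 0 (√3 * ‖ω‖) := by
  have := sqrt_three_mul_norm_pos hω
  constructor <;> linarith

theorem two_thirds_mem_Ioo (hω : ω ≠ 0) : 2 * √3 * ‖ω‖ / 3 ∈ Set.Ioo 0 (√3 * ‖ω‖) := by
  have := sqrt_three_mul_norm_pos hω
  constructor <;> linarith

theorem weierstrassP_third_eq_zero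
    (harg : ω = (‖ω‖ : ℂ) * Complex.exp (Real.pi * Complex.I / 6))
    (hL : (L.lattice : Set ℂ) = hexagonalLattice ω) :
    L.weierstrassP ((√3 * ‖ω‖ / 3 : ℝ) : ℂ) = 0 := by
  refine weierstrassP_eq_zero_of_hexagonal hL ?_
  rw [mem_lattice_iff_of_hexagonal hL]
  -- Here (ε² - 1) · √3|ω|/3 = (ε - 2) · √3|ω|/3 = -ω + i|ω|.
  refine ⟨-1, 1, ?_⟩
  have h2 := ofReal_norm_mul_exp harg
  rw [mul_exp_pi_mul_I_div_three harg, exp_pi_mul_I_div_three_sq, exp_pi_mul_I_div_three]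
  generalize ‖ω‖ = r at h2
  rw [h2]
  push_cast
  linear_combination r * Complex.I / 6 * ofReal_sqrt_three_sq

theorem sqrt_three_mul_norm_mem_lattice (hω : ω ≠ 0)
    (harg : ω = (‖ω‖ : ℂ) * Complex.exp (Real.pi * Complex.I / 6))
    (hL : (L.lattice : Set ℂ) = hexagonalLattice ω) :
    ((√3 * ‖ω‖ : ℝ) : ℂ) ∈ L.lattice :=
  (ofReal_mem_lattice_iff hω harg hL _).mpr ⟨1, by simp⟩

theorem weierstrassP_period_sub (hω : ω ≠ 0)
    (harg : ω = (‖ω‖ : ℂ) * Complex.exp (Real.pi * Complex.I / 6))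
    (hL : (L.lattice : Set ℂ) = hexagonalLattice ω) (x : ℝ) :
    L.weierstrassP ((√3 * ‖ω‖ - x : ℝ) : ℂ) = L.weierstrassP x := by
  have h := L.weierstrassP_add_coe (-x) ⟨_, sqrt_three_mul_norm_mem_lattice hω harg hL⟩
  rw [L.weierstrassP_neg] at h
  rw [← h]
  congr 1
  push_cast
  ring

theorem derivWeierstrassP_period_sub (hω : ω ≠ 0)
    (harg : ω = (‖ω‖ : ℂ) * Complex.exp (Real.pi * Complex.I / 6))
    (hL : (L.lattice : Set ℂ) = hexagonalLattice ω) (x : ℝ) :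
    L.derivWeierstrassP ((√3 * ‖ω‖ - x : ℝ) : ℂ) = -L.derivWeierstrassP x := by
  have h := L.derivWeierstrassP_add_coe (-x) ⟨_, sqrt_three_mul_norm_mem_lattice hω harg hL⟩
  rw [L.derivWeierstrassP_neg] at h
  rw [← h]
  congr 1
  push_cast
  ring

theorem weierstrassP_two_thirds_eq_zero (hω : ω ≠ 0)
    (harg : ω = (‖ω‖ : ℂ) * Complex.exp (Real.pi * Complex.I / 6))
    (hL : (L.lattice : Set ℂ) = hexagonalLattice ω) :
    L.weierstrassP ((2 * √3 * ‖ω‖ / 3 : ℝ) : ℂ) = 0 := by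
  rw [← weierstrassP_period_sub hω harg hL, ← weierstrassP_third_eq_zero harg hL]
  congr 2
  ring

/-- At a zero the cubic equation reads (℘')² = -g₃, so every zero of ℘ is simple. -/
theorem derivWeierstrassP_ne_zero_of_zero (hL : (L.lattice : Set ℂ) = hexagonalLattice ω) {z : ℂ}
    (hz : z ∉ L.lattice) (h0 : L.weierstrassP z = 0) : L.derivWeierstrassP z ≠ 0 := by
  intro h
  have h1 := L.derivWeierstrassP_sq z hz
  rw [h0, h] at h1
  exact g₃_ne_zero_of_g₂_eq_zero (g₂_eq_zero_of_hexagonal hL) (by linear_combination h1)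

/-- For a hexagonal lattice symmetric about the real axis in this position, `C` is the square of
the real number `℘'(√3 |ω| / 3)`. -/
theorem exists_pos_satisfiesCubicODE (hω : ω ≠ 0)
    (harg : ω = (‖ω‖ : ℂ) * Complex.exp (Real.pi * Complex.I / 6))
    (hL : (L.lattice : Set ℂ) = hexagonalLattice ω) :
    ∃ C : ℝ, 0 < C ∧ SatisfiesCubicODE L (C : ℂ) := by
  set p : ℝ := √3 * ‖ω‖ / 3 with hp
  have hpL : (p : ℂ) ∉ L.lattice := ofReal_notMem_lattice hω harg hL (third_mem_Ioo hω)
  have hzero : L.weierstrassP p = 0 := weierstrassP_third_eq_zero harg hL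
  have hne := derivWeierstrassP_ne_zero_of_zero hL hpL hzero
  have him := im_derivWeierstrassP_ofReal (conj_mem_lattice_iff harg hL) p
  have hre : L.derivWeierstrassP p = ((L.derivWeierstrassP p).re : ℂ) := by
    apply Complex.ext <;> simp [him]
  refine ⟨(L.derivWeierstrassP p).re ^ 2, ?_, ?_⟩
  · refine sq_pos_of_ne_zero fun h => hne ?_
    rw [hre, h, Complex.ofReal_zero]
  · convert satisfiesCubicODE_of_hexagonal hL using 1
    rw [Complex.ofReal_pow, ← hre, L.derivWeierstrassP_sq _ hpL, hzero]
    ring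

/-- Rotating by c = ω / ω₀, |c| = 1, gives a standard lattice with constant C' > 0 and c⁶C' = C.
Taking norms, C' = C, so c⁶ = 1 and the rotation preserves the lattice. -/
theorem exists_hexagonal_of_pos_satisfiesCubicODE {C : ℝ} (hC : 0 < C)
    (h : SatisfiesCubicODE L (C : ℂ)) :
    ∃ ω : ℂ, ω ≠ 0 ∧ ω = (‖ω‖ : ℂ) * Complex.exp (Real.pi * Complex.I / 6) ∧
      (L.lattice : Set ℂ) = hexagonalLattice ω := by
  obtain ⟨ω₀, hω₀, hL⟩ := exists_hexagonal_of_satisfiesCubicODE h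
  set ω : ℂ := ‖ω₀‖ * Complex.exp (Real.pi * Complex.I / 6) with hωdef
  have hnorm : ‖ω‖ = ‖ω₀‖ := by
    rw [hωdef, show (Real.pi * Complex.I / 6 : ℂ) = ((Real.pi / 6 : ℝ) : ℂ) * Complex.I by
      push_cast; ring, norm_mul, Complex.norm_exp_ofReal_mul_I, mul_one, Complex.norm_real,
      norm_norm]
  have hω : ω ≠ 0 := by rw [← norm_pos_iff, hnorm]; exact norm_pos_iff.mpr hω₀
  have harg : ω = (‖ω‖ : ℂ) * Complex.exp (Real.pi * Complex.I / 6) := by rw [hnorm]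
  have hc : ω / ω₀ ≠ 0 := div_ne_zero hω hω₀
  have hcω : ω / ω₀ * ω₀ = ω := div_mul_cancel₀ _ hω₀
  have hs := mul_mem_lattice_scale (L := L) hc
  have hhex : ∀ z, z ∈ hexagonalLattice ω ↔ (ω / ω₀)⁻¹ * z ∈ hexagonalLattice ω₀ := fun z => by
    rw [← mul_mem_hexagonalLattice_mul (z := _⁻¹ * z) hc, mul_inv_cancel_left₀ hc, hcω]
  have hL' : ((L.scale _ hc).lattice : Set ℂ) = hexagonalLattice ω := by
    ext z
    rw [SetLike.mem_coe, hhex, ← mem_lattice_iff_of_hexagonal hL, ← hs, mul_inv_cancel_left₀ hc]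
  obtain ⟨C', hC', h'⟩ := exists_pos_satisfiesCubicODE hω harg hL'
  have hg := g₃_eq_of_mul hc hs
  rw [(satisfiesCubicODE_iff.mp h).2, (satisfiesCubicODE_iff.mp h').2,
    eq_inv_mul_iff_mul_eq₀ (pow_ne_zero 6 hc), mul_neg, neg_inj] at hg
  have hCC : C' = C := by
    have := congrArg norm hg
    rwa [norm_mul, norm_pow, norm_div, hnorm, div_self (norm_ne_zero_iff.mpr hω₀), one_pow,
      one_mul, Complex.norm_of_nonneg hC'.le, Complex.norm_of_nonneg hC.le] at this
  rw [hCC] at hg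
  have h6 : (ω / ω₀) ^ 6 = 1 :=
    mul_right_cancel₀ (Complex.ofReal_ne_zero.mpr hC.ne') (by rw [hg, one_mul])
  refine ⟨ω, hω, harg, ?_⟩
  ext z
  rw [hL, hhex, ← mul_mem_hexagonalLattice_of_pow_six (z := _⁻¹ * z) h6,
    mul_inv_cancel_left₀ hc]

/-! ### Zeros and monotonicity. -/

theorem mul_exp_neg_pi_mul_I_div_three
    (harg : ω = (‖ω‖ : ℂ) * Complex.exp (Real.pi * Complex.I / 6)) :
    ω * Complex.exp (-(Real.pi * Complex.I / 3)) = ‖ω‖ * (√3 / 2 - 1 / 2 * Complex.I) := by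
  have h1 := mul_exp_pi_mul_I_div_three harg
  have h2 := ofReal_norm_mul_exp harg
  rw [exp_pi_mul_I_div_three] at h1
  rw [exp_neg_pi_mul_I_div_three]
  linear_combination h2 - h1

/-- Coordinates with respect to `ω`, `ω e^{-π i / 3}` of the points of the lattice are integers. -/
theorem exists_int_of_mem_hexagonalLattice (hω : ω ≠ 0)
    (harg : ω = (‖ω‖ : ℂ) * Complex.exp (Real.pi * Complex.I / 6)) {s t : ℝ}
    (h : (s * ω + t * (ω * Complex.exp (-(Real.pi * Complex.I / 3))) : ℂ) ∈ hexagonalLattice ω) :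
    ∃ m n : ℤ, s = m ∧ t = n := by
  obtain ⟨m, n, h⟩ := h
  have hr := norm_pos_iff.mpr hω
  have h2 := ofReal_norm_mul_exp harg
  rw [mul_exp_pi_mul_I_div_three harg, mul_exp_neg_pi_mul_I_div_three harg] at h
  generalize ‖ω‖ = r at *
  rw [h2] at h
  have hre := congrArg Complex.re h
  have him := congrArg Complex.im h
  simp at hre him
  have e1 : s + t = m :=
    mul_left_cancel₀ (mul_pos hr (by positivity : (0 : ℝ) < √3)).ne' (by linear_combination 2 * hre)
  have e2 : s - t = m + 2 * n := mul_left_cancel₀ hr.ne' (by linear_combination 2 * him)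
  exact ⟨m + n, -n, by push_cast; linarith, by push_cast; linarith⟩

theorem ofReal_mul_period_eq (harg : ω = (‖ω‖ : ℂ) * Complex.exp (Real.pi * Complex.I / 6)) (x : ℝ) :
    ((x * (√3 * ‖ω‖) : ℝ) : ℂ) =
      x * ω + x * (ω * Complex.exp (-(Real.pi * Complex.I / 3))) := by
  have h2 := ofReal_norm_mul_exp harg
  rw [mul_exp_neg_pi_mul_I_div_three harg]
  push_cast
  linear_combination -x * h2

theorem zeros_in_fundamentalParallelogram (hω : ω ≠ 0)
    (harg : ω = (‖ω‖ : ℂ) * Complex.exp (Real.pi * Complex.I / 6))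
    (hL : (L.lattice : Set ℂ) = hexagonalLattice ω) :
    {z : ℂ | z ∈ fundamentalParallelogram ω (ω * Complex.exp (-(Real.pi * Complex.I / 3))) ∧
        z ∉ L.lattice ∧ L.weierstrassP z = 0} =
      {((√3 * ‖ω‖ / 3 : ℝ) : ℂ), ((2 * √3 * ‖ω‖ / 3 : ℝ) : ℂ)} := by
  have hp := ofReal_notMem_lattice hω harg hL (third_mem_Ioo hω)
  have hq := ofReal_notMem_lattice hω harg hL (two_thirds_mem_Ioo hω)
  have hp0 := weierstrassP_third_eq_zero harg hL
  have hq0 := weierstrassP_two_thirds_eq_zero hω harg hL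
  have hp1 := derivWeierstrassP_ne_zero_of_zero hL hp hp0
  have ep : ((√3 * ‖ω‖ / 3 : ℝ) : ℂ) = _ :=
    Eq.trans (by push_cast; ring) (ofReal_mul_period_eq harg (1 / 3))
  have eq : ((2 * √3 * ‖ω‖ / 3 : ℝ) : ℂ) = _ :=
    Eq.trans (by push_cast; ring) (ofReal_mul_period_eq harg (2 / 3))
  ext z
  simp only [Set.mem_ofPred_eq, Set.mem_insert_iff, Set.mem_singleton_iff]
  constructor
  · rintro ⟨⟨s, t, hs, ht, hz⟩, hzL, hz0⟩
    have key : ∀ {u : ℝ} {k : ℤ}, u ∈ Set.Ico (0 : ℝ) 1 → u - 1 / 3 = k → u = 1 / 3 := by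
      intro u k hu h
      have h1 : (-1 : ℝ) < k := by linarith [hu.1]
      have h2 : (k : ℝ) < 1 := by linarith [hu.2]
      norm_cast at h1 h2
      rw [show k = 0 by omega, Int.cast_zero] at h
      linarith
    have key' : ∀ {u : ℝ} {k : ℤ}, u ∈ Set.Ico (0 : ℝ) 1 → u + 1 / 3 = k → u = 2 / 3 := by
      intro u k hu h
      have h1 : (0 : ℝ) < k := by linarith [hu.1]
      have h2 : (k : ℝ) < 2 := by linarith [hu.2]
      norm_cast at h1 h2
      rw [show k = 1 by omega, Int.cast_one] at h
      linarith
    -- Every zero is ≡ ±√3|ω|/3, a point with both coordinates 1/3; the representatives in the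
    -- half-open cell have both coordinates 1/3 or both 2/3.
    rcases sub_mem_or_add_mem_lattice_of_weierstrassP_eq hp hzL (hz0.trans hp0.symm) hp1 with
      h | h
    · left
      obtain ⟨m, n, hm, hn⟩ := exists_int_of_mem_hexagonalLattice (s := s - 1 / 3)
        (t := t - 1 / 3) hω harg (by
          rw [← mem_lattice_iff_of_hexagonal hL]
          convert h using 1
          rw [hz, ep]; push_cast; ring)
      rw [hz, ep, key hs hm, key ht hn]
    · right
      obtain ⟨m, n, hm, hn⟩ := exists_int_of_mem_hexagonalLattice (s := s + 1 / 3)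
        (t := t + 1 / 3) hω harg (by
          rw [← mem_lattice_iff_of_hexagonal hL]
          convert h using 1
          rw [hz, ep]; push_cast; ring)
      rw [hz, eq, key' hs hm, key' ht hn]
  · rintro (rfl | rfl)
    · exact ⟨⟨1 / 3, 1 / 3, by norm_num, by norm_num, ep⟩, hp, hp0⟩
    · exact ⟨⟨2 / 3, 2 / 3, by norm_num, by norm_num, eq⟩, hq, hq0⟩

/-- On the real axis `℘'' = 6 ℘² ≥ 0`, so `℘'` is nonnegative beyond the half period. -/
theorem strictMonoOn_weierstrassP_re (hω : ω ≠ 0)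
    (harg : ω = (‖ω‖ : ℂ) * Complex.exp (Real.pi * Complex.I / 6))
    (hL : (L.lattice : Set ℂ) = hexagonalLattice ω) :
    StrictMonoOn (fun x : ℝ => (L.weierstrassP (x : ℂ)).re)
      (Set.Ioo (2 * √3 * ‖ω‖ / 3) (√3 * ‖ω‖)) := by
  have hpos := sqrt_three_mul_norm_pos hω
  have hmem := fun x hx => ofReal_notMem_lattice hω harg hL (x := x) hx
  have hconj := conj_mem_lattice_iff harg hL
  have hq := two_thirds_mem_Ioo hω
  have hq1 := derivWeierstrassP_ne_zero_of_zero hL (hmem _ hq)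
    (weierstrassP_two_thirds_eq_zero hω harg hL)
  have hd : ∀ x ∈ Set.Ioo 0 (√3 * ‖ω‖), HasDerivAt (fun x : ℝ => (L.weierstrassP (x : ℂ)).re)
      (L.derivWeierstrassP x).re x := fun x hx =>
    (L.hasDerivAt_weierstrassP (hmem x hx)).real_of_complex
  have hd' : ∀ x ∈ Set.Ioo 0 (√3 * ‖ω‖),
      HasDerivAt (fun x : ℝ => (L.derivWeierstrassP (x : ℂ)).re)
        (6 * L.weierstrassP x ^ 2 - L.g₂ / 2).re x := fun x hx =>
    (hasDerivAt_derivWeierstrassP (hmem _ hq) hq1 (hmem x hx)).real_of_complex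
  have hmono : MonotoneOn (fun x : ℝ => (L.derivWeierstrassP (x : ℂ)).re)
      (Set.Ioo 0 (√3 * ‖ω‖)) := by
    refine monotoneOn_of_deriv_nonneg (convex_Ioo _ _)
      (fun x hx => (hd' x hx).continuousAt.continuousWithinAt)
      (fun x hx => (hd' x (interior_subset hx)).differentiableAt.differentiableWithinAt)
      fun x hx => ?_
    rw [(hd' x (interior_subset hx)).deriv, g₂_eq_zero_of_hexagonal hL]
    have him := im_weierstrassP_ofReal hconj x
    simp [pow_two, him, mul_self_nonneg]
  -- The half period is fixed by x ↦ √3|ω| - x, under which ℘' changes sign.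
  have hhalf : (L.derivWeierstrassP ((√3 * ‖ω‖ / 2 : ℝ) : ℂ)).re = 0 := by
    have h := derivWeierstrassP_period_sub hω harg hL (√3 * ‖ω‖ / 2)
    rw [sub_half] at h
    have := congrArg Complex.re h
    rw [Complex.neg_re] at this
    linarith
  -- The inequality is strict because 2√3|ω|/3 is a simple zero of ℘.
  have hqpos : 0 < (L.derivWeierstrassP ((2 * √3 * ‖ω‖ / 3 : ℝ) : ℂ)).re := by
    refine lt_of_le_of_ne ?_ fun h => hq1 (Complex.ext h.symm (im_derivWeierstrassP_ofReal hconj _))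
    rw [← hhalf]
    exact hmono ⟨by linarith, by linarith⟩ hq (by linarith)
  have hsub : ∀ x ∈ Set.Ioo (2 * √3 * ‖ω‖ / 3) (√3 * ‖ω‖), x ∈ Set.Ioo 0 (√3 * ‖ω‖) :=
    fun x hx => ⟨hq.1.trans hx.1, hx.2⟩
  refine strictMonoOn_of_deriv_pos (convex_Ioo _ _)
    (fun x hx => (hd x (hsub x hx)).continuousAt.continuousWithinAt) fun x hx => ?_
  have hx := interior_subset hx
  rw [(hd x (hsub x hx)).deriv]
  exact hqpos.trans_le (hmono hq (hsub x hx) hx.1.le)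

end RealHexagonal

theorem mainTheorem11 (L : PeriodPair) :
    ((∃ C : ℂ, C ≠ 0 ∧ SatisfiesCubicODE L C) ↔
      ∃ ω : ℂ, ω ≠ 0 ∧ (L.lattice : Set ℂ) = hexagonalLattice ω) ∧
    ((∃ C : ℝ, 0 < C ∧ SatisfiesCubicODE L (C : ℂ)) ↔
      ∃ ω : ℂ, ω ≠ 0 ∧ ω = (‖ω‖ : ℂ) * Complex.exp (Real.pi * Complex.I / 6) ∧
        (L.lattice : Set ℂ) = hexagonalLattice ω) ∧
    (∀ ω : ℂ, ω ≠ 0 → ω = (‖ω‖ : ℂ) * Complex.exp (Real.pi * Complex.I / 6) →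
      (L.lattice : Set ℂ) = hexagonalLattice ω →
      (∀ x : ℝ, meromorphicOrderAt L.weierstrassP (x : ℂ) < 0 ↔
        ∃ k : ℤ, x = k * (√3 * ‖ω‖)) ∧
      (∀ x : ℝ, (x : ℂ) ∉ L.lattice → (L.weierstrassP (x : ℂ)).im = 0) ∧
      {z : ℂ | z ∈ fundamentalParallelogram ω (ω * Complex.exp (-(Real.pi * Complex.I / 3))) ∧
          z ∉ L.lattice ∧ L.weierstrassP z = 0} =
        {((√3 * ‖ω‖ / 3 : ℝ) : ℂ), ((2 * √3 * ‖ω‖ / 3 : ℝ) : ℂ)} ∧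
      StrictMonoOn (fun x : ℝ => (L.weierstrassP (x : ℂ)).re)
        (Set.Ioo (2 * √3 * ‖ω‖ / 3) (√3 * ‖ω‖))) := by
  refine ⟨⟨?_, ?_⟩, ⟨?_, ?_⟩, fun ω hω harg hL => ⟨fun x => ?_, fun x _ => ?_, ?_, ?_⟩⟩
  · rintro ⟨C, -, h⟩
    exact exists_hexagonal_of_satisfiesCubicODE h
  · rintro ⟨ω, -, hL⟩
    exact ⟨-L.g₃, neg_ne_zero.mpr (g₃_ne_zero_of_g₂_eq_zero (g₂_eq_zero_of_hexagonal hL)),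
      satisfiesCubicODE_of_hexagonal hL⟩
  · rintro ⟨C, hC, h⟩
    exact exists_hexagonal_of_pos_satisfiesCubicODE hC h
  · rintro ⟨ω, hω, harg, hL⟩
    exact exists_pos_satisfiesCubicODE hω harg hL
  · rw [meromorphicOrderAt_weierstrassP_neg_iff, ofReal_mem_lattice_iff hω harg hL]
  · exact im_weierstrassP_ofReal (conj_mem_lattice_iff harg hL) x
  · exact zeros_in_fundamentalParallelogram hω harg hL
  · exact strictMonoOn_weierstrassP_re hω harg hL
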